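/- Let $\lambda$ be an infinite regular cardinal, regarded as the ordered set of all ordinals $i<\lambda$. For an ordinal $\mu>0$, a $\mu$-chain in a category $\mathfrak{D}$ is a functor from the ordered set $\mu=\{i : i<\mu\}$ to $\mathfrak{D}$. An object $X$ of $\mathfrak{D}$ is $\lambda$-small if for every $\lambda$-chain $H$ in $\mathfrak{D}$ with colimit cocone $(S,(s_i)_{i<\lambda})$ and every $h:X\to S$ there are $j<\lambda$ and $g:X\to Hj$ with $h=s_j\circ g$; $\mathfrak{D}_{<\lambda}$ denotes the full subcategory of $\lambda$-small objects. $\mathfrak{D}$ is $\lambda$-algebroidal if for all $0<\mu\le\lambda$ every $\mu$-chain of $\lambda$-small objects has a colimit in $\mathfrak{D}$, every object of $\mathfrak{D}$ is the colimit of a $\lambda$-chain of $\lambda$-small objects, $\mathfrak{D}_{<\lambda}$ has at most $\lambda$ isomorphism classes of objects, and between any two objects of $\mathfrak{D}_{<\lambda}$ there are at most $\lambda$ morphisms. A category $\mathfrak{D}$ has the joint embedding property (JEP) if any two objects admit morphisms to a common object, and the amalgamation property (AP) if for all $f:X\to Y$, $g:X\to Z$ there are $\hat f:Z\to D$, $\hat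 g:Y\to D$ with $\hat g\circ f=\hat f\circ g$. For functors $F:\mathfrak{A}\to\mathfrak{C}$ and $G:\mathfrak{B}\to\mathfrak{C}$ we say that $\mathfrak{A}$ has - the $(F,G)$-joint embedding property if for all $B_1,B_2\in\mathfrak{A}$, $T\in\mathfrak{B}$, $h_1:FB_1\to GT$, $h_2:FB_2\to GT$ there are $C\in\mathfrak{A}$, $T'\in\mathfrak{B}$, $f_i:B_i\to C$, $k_i:T\to T'$ ($i=1,2$) and $h:FC\to GT'$ with $h\circ Ff_i=Gk_i\circ h_i$ for $i=1,2$; - the $(F,G)$-amalgamation property if for all $f_1:A\to B_1$, $f_2:A\to B_2$ in $\mathfrak{A}$, $T\in\mathfrak{B}$, $h_1:FB_1\to GT$, $h_2:FB_2\to GT$ with $h_1\circ Ff_1=h_2\circ Ff_2$ there are $C\in\mathfrak{A}$, $g_i:B_i\to C$ ($i=1,2$), $T'\in\mathfrak{B}$, $k:T\to T'$ and $h:FC\to GT'$ with $g_1\circ f_1=g_2\circ f_2$ and $h\circ Fg_i=Gk\circ h_i$ for $i=1,2$. **Theorem.** Let $\mathfrak{A}$ and $\mathfrak{B}$ be $\lambda$-algebroidal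 categories all of whose morphisms are monomorphisms, and suppose that $\mathfrak{B}_{<\lambda}$ has the JEP and the AP. Let $\mathfrak{C}$ be any category and let $F:\mathfrak{A}\to\mathfrak{C}$, $G:\mathfrak{B}\to\mathfrak{C}$ be functors such that the comma category $(F\downarrow G)$ is nonempty and 1. $F$ maps colimit cocones of $\lambda$-chains in $\mathfrak{A}$ to colimit cocones and, for all $0<\mu<\lambda$, maps colimit cocones of $\mu$-chains of $\lambda$-small objects to colimit cocones; 2. $F$ preserves $\lambda$-smallness with respect to $G$: for every $\lambda$-chain $H$ in $\mathfrak{B}$ with colimit cocone $(B,(g_i)_{i<\lambda})$, every $A\in\mathfrak{A}_{<\lambda}$ and every $f:FA\to GB$ there are $j<\lambda$ and $h:FA\to GHj$ with $Gg_j\circ h=f$; 3. $G$ maps colimit cocones of $\lambda$-chains of $\lambda$-small objects to colimit cocones; 4. $G$ preserves monomorphisms; 5. for all $A\in\mathfrak{A}_{<\lambda}$ and $B\in\mathfrak{B}_{<\lambda}$ there are at most $\lambda$ morphisms $FA\to GB$ in $\mathfrak{C}$. Then the following are equivalent: - $(F\downarrow G)$ contains an $(F\downarrow G)$-universal, $(F\downarrow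 G)_{<\lambda}$-homogeneous object, that is, an object $U$ such that every object of $(F\downarrow G)$ admits a morphism to $U$, and such that for every $\lambda$-small object $X$ of $(F\downarrow G)$ and all $f,g:X\to U$ there is an automorphism $h$ of $U$ with $h\circ f=g$; - $\mathfrak{A}_{<\lambda}$ has the $(F{\upharpoonright}_{\mathfrak{A}_{<\lambda}},G{\upharpoonright}_{\mathfrak{B}_{<\lambda}})$-joint embedding property and the $(F{\upharpoonright}_{\mathfrak{A}_{<\lambda}},G{\upharpoonright}_{\mathfrak{B}_{<\lambda}})$-amalgamation property. -/

import Mathlib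

open CategoryTheory CategoryTheory.Limits

universe w u v u₁ v₁ u₂ v₂ u₃ v₃

namespace CommaFraisse

/-- A `μ`-chain in `C`: a functor from the ordinal `μ`, seen as the ordered set of all ordinals
`i < μ`, to `C`. -/
abbrev Chain (μ : Ordinal.{w}) (C : Type u) [Category.{v} C] :=
  Set.Iio μ ⥤ C

/-- `A` is `κ`-small: every morphism from `A` to a colimit of a `κ`-chain factors through some
member of the chain. -/
def IsSmall (κ : Cardinal.{w}) (C : Type u) [Category.{v} C] : ObjectProperty C := fun A =>
  ∀ (H : Chain κ.ord C) (c : Cocone H), Nonempty (IsColimit c) → ∀ h : A ⟶ c.pt,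
    ∃ (j : Set.Iio κ.ord) (g : A ⟶ H.obj j), g ≫ c.ι.app j = h

/-- The full subcategory `C_{<κ}` of all `κ`-small objects of `C`. -/
abbrev SmallPart (κ : Cardinal.{w}) (C : Type u) [Category.{v} C] :=
  (IsSmall κ C).FullSubcategory

/-- The inclusion functor of `C_{<κ}` into `C`. -/
abbrev smallIncl (κ : Cardinal.{w}) (C : Type u) [Category.{v} C] : SmallPart κ C ⥤ C :=
  (IsSmall κ C).ι

/-- Semi-`κ`-algebroidal categories. Chains are nonempty (`0 < μ`): an initial object is not
required. -/
structure IsSemiAlgebroidal (κ : Cardinal.{w}) (C : Type u) [Category.{v} C] : Prop where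
  hasColimit : ∀ μ : Ordinal.{w}, 0 < μ → μ ≤ κ.ord → ∀ H : Chain μ C,
    (∀ i, IsSmall κ C (H.obj i)) → HasColimit H
  exists_chain : ∀ X : C, ∃ H : Chain κ.ord C, (∀ i, IsSmall κ C (H.obj i)) ∧
    ∃ s : H ⟶ (Functor.const (Set.Iio κ.ord)).obj X, Nonempty (IsColimit (Cocone.mk X s))

/-- `κ`-algebroidal categories. -/
structure IsAlgebroidal (κ : Cardinal.{w}) (C : Type u) [Category.{v} C] : Prop
    extends IsSemiAlgebroidal κ C where
  card_isoClasses_le : Cardinal.lift.{w} (Cardinal.mk (Quotient (isIsomorphicSetoid (SmallPart κ C))))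
    ≤ Cardinal.lift.{u} κ
  card_hom_le : ∀ A B : C, IsSmall κ C A → IsSmall κ C B →
    Cardinal.lift.{w} (Cardinal.mk (A ⟶ B)) ≤ Cardinal.lift.{v} κ

/-- All morphisms of `C` are monomorphisms. -/
def AllMono (C : Type u) [Category.{v} C] : Prop :=
  ∀ ⦃X Y : C⦄ (f : X ⟶ Y), Mono f

section Functors

variable {A : Type u₁} [Category.{v₁} A] {B : Type u₂} [Category.{v₂} B]
  {C : Type u₃} [Category.{v₃} C]

/-- `F` is `κ`-cocontinuous: it maps limiting cocones of `κ`-chains to limiting cocones. -/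
def IsCocontinuous (κ : Cardinal.{w}) (F : A ⥤ C) : Prop :=
  ∀ (H : Chain κ.ord A) (c : Cocone H), Nonempty (IsColimit c) →
    Nonempty (IsColimit (F.mapCocone c))

/-- `F` is `μ_{<κ}`-cocontinuous: it maps limiting cocones of `μ`-chains of `κ`-small objects to
limiting cocones. -/
def IsCocontinuousOnSmall (μ : Ordinal.{w}) (κ : Cardinal.{w}) (F : A ⥤ C) : Prop :=
  ∀ (H : Chain μ A), (∀ i, IsSmall κ A (H.obj i)) → ∀ c : Cocone H, Nonempty (IsColimit c) →
    Nonempty (IsColimit (F.mapCocone c))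

/-- `F` preserves `κ`-smallness with respect to `G`. -/
def PreservesSmallness (κ : Cardinal.{w}) (F : A ⥤ C) (G : B ⥤ C) : Prop :=
  ∀ (H : Chain κ.ord B) (c : Cocone H), Nonempty (IsColimit c) →
    ∀ X : A, IsSmall κ A X → ∀ f : F.obj X ⟶ G.obj c.pt,
      ∃ (j : Set.Iio κ.ord) (h : F.obj X ⟶ G.obj (H.obj j)), h ≫ G.map (c.ι.app j) = f

/-- `A` has the `(F, G)`-joint embedding property. -/
def HasRelJEP (F : A ⥤ C) (G : B ⥤ C) : Prop :=
  ∀ (B₁ B₂ : A) (T : B) (h₁ : F.obj B₁ ⟶ G.obj T) (h₂ : F.obj B₂ ⟶ G.obj T),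
    ∃ (D : A) (T' : B) (f₁ : B₁ ⟶ D) (f₂ : B₂ ⟶ D) (h : F.obj D ⟶ G.obj T') (k₁ k₂ : T ⟶ T'),
      F.map f₁ ≫ h = h₁ ≫ G.map k₁ ∧ F.map f₂ ≫ h = h₂ ≫ G.map k₂

/-- `A` has the `(F, G)`-amalgamation property. -/
def HasRelAP (F : A ⥤ C) (G : B ⥤ C) : Prop :=
  ∀ (X B₁ B₂ : A) (f₁ : X ⟶ B₁) (f₂ : X ⟶ B₂) (T : B)
    (h₁ : F.obj B₁ ⟶ G.obj T) (h₂ : F.obj B₂ ⟶ G.obj T), F.map f₁ ≫ h₁ = F.map f₂ ≫ h₂ →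
    ∃ (D : A) (g₁ : B₁ ⟶ D) (g₂ : B₂ ⟶ D) (T' : B) (k : T ⟶ T') (h : F.obj D ⟶ G.obj T'),
      f₁ ≫ g₁ = f₂ ≫ g₂ ∧ F.map g₁ ≫ h = h₁ ≫ G.map k ∧ F.map g₂ ≫ h = h₂ ≫ G.map k

end Functors

section Objects

variable (C : Type u) [Category.{v} C]

/-- The joint embedding property. -/
def HasJEP : Prop :=
  ∀ X Y : C, ∃ (Z : C) (_ : X ⟶ Z) (_ : Y ⟶ Z), True

/-- The amalgamation property. -/
def HasAP : Prop :=
  ∀ (X Y Z : C) (f : X ⟶ Y) (g : X ⟶ Z), ∃ (D : C) (f' : Z ⟶ D) (g' : Y ⟶ D), f ≫ g' = g ≫ f'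

variable {C}

/-- `U` is universal for the objects of the full subcategory given by `P`. -/
def IsUniversal (P : ObjectProperty C) (U : C) : Prop :=
  ∀ X : C, P X → Nonempty (X ⟶ U)

/-- `U` is homogeneous for the objects of the full subcategory given by `P`. -/
def IsHomogeneous (P : ObjectProperty C) (U : C) : Prop :=
  ∀ X : C, P X → ∀ f g : X ⟶ U, ∃ h : U ≅ U, f ≫ h.hom = g

end Objects

end CommaFraisse

/-! The theorem is Fraïssé's theorem in the comma category, where the objects with both components
`κ`-small play the part of the finite structures. `IsSmallBase` isolates what the argument needs
from such a class `P`: monic morphisms, colimits of short chains inside `P`, colimits of `κ`-chains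
from `P` through which maps from `P` factor, and every object being such a colimit.
`isSmallBase_comma` verifies this: colimits are componentwise because `F` preserves them, and
compatibility squares can be checked after a monomorphism in the image of `G`.

A universal homogeneous object yields joint embedding and amalgamation, since diagrams completed in
`U` already live in a member of a chain of `P`-objects with colimit `U`. Conversely,
`exists_isSaturated` builds a chain of length `κ` that absorbs every extension of each of its
members; at most `κ` extensions matter, by `hasDominatingMaps_comma`. Its colimit is saturated.
Saturation gives universality by extending maps along a chain, and homogeneity by back-and-forth.

By `isSmall` and `exists_iso`, `P` is the class of `κ`-small objects up to isomorphism. Finally,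
given JEP and AP for the small part of `B`, joint embedding and amalgamation for `P` amount to the
relative properties of `A`. -/

namespace CommaFraisse

/-! ### Transfinite dependent choice -/

/-- Transfinite dependent choice: if every coherent family on an initial segment extends, then
there is a coherent family on the whole well-order. -/
theorem exists_coherent_family {J : Type*} [LinearOrder J] [WellFoundedLT J] {T : J → Type*}
    [hT : ∀ j, Nonempty (T j)]
    (r : ∀ i j, T i → T j → Prop) (s : ∀ j, (∀ i, i < j → T i) → T j → Prop)
    (ext : ∀ j (p : ∀ i, i < j → T i),
      (∀ i i' (hi : i < j) (hi' : i' < j), i < i' → r i i' (p i hi) (p i' hi')) →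
      ∃ x : T j, (∀ i (hi : i < j), r i j (p i hi) x) ∧ s j p x) :
    ∃ p : ∀ j, T j, (∀ i j, i < j → r i j (p i) (p j)) ∧ ∀ j, s j (fun i _ => p i) (p j) := by
  classical
  choose g hg using ext
  -- The default value is never taken: `hr` shows by induction that the values already chosen are
  -- coherent.
  let P : ∀ i, T i := fun i => WellFoundedLT.fix (motive := T)
    (fun i rec => if h : _ then g i rec h else (hT i).some) i
  have hP : ∀ i, P i = if h : _ then g i (fun k _ => P k) h else (hT i).some :=
    fun i => WellFoundedLT.fix_eq (motive := T) _ i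
  have hr : ∀ j i, i < j → r i j (P i) (P j) := by
    intro j
    induction j using WellFoundedLT.induction with
    | ind j ih =>
      intro i h
      have hc : ∀ a b, a < j → b < j → a < b → r a b (P a) (P b) :=
        fun a b _ hb hab => ih b hb a hab
      rw [hP j, dif_pos hc]
      exact (hg j (fun k _ => P k) hc).1 i h
  refine ⟨P, fun i j h => hr j i h, fun j => ?_⟩
  have hc : ∀ a b, a < j → b < j → a < b → r a b (P a) (P b) :=
    fun a b _ _ hab => hr b a hab
  rw [hP j, dif_pos hc]
  exact (hg j (fun k _ => P k) hc).2

/-! ### Functors on preorders from unique transition maps -/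

section Thin

variable {J : Type*} [Preorder J] {E : Type u} [Category.{v} E]

/-- A functor from a preorder out of a selection of exactly one map for each inequality. -/
noncomputable def functorOfUnique (X : J → E) (M : ∀ i j, (X i ⟶ X j) → Prop)
    (ex : ∀ i j, i ≤ j → ∃ m, M i j m) (uniq : ∀ i j m m', M i j m → M i j m' → m = m')
    (hid : ∀ i, M i i (𝟙 _))
    (hcomp : ∀ i j k m m', i ≤ j → j ≤ k → M i j m → M j k m' → M i k (m ≫ m')) : J ⥤ E where
  obj := X
  map f := (ex _ _ (leOfHom f)).choose
  map_id i := uniq _ _ _ _ (ex i i le_rfl).choose_spec (hid i)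
  map_comp {i _ k} f g := uniq _ _ _ _ (ex i k (leOfHom (f ≫ g))).choose_spec
    (hcomp _ _ _ _ _ (leOfHom f) (leOfHom g)
      (ex _ _ (leOfHom f)).choose_spec (ex _ _ (leOfHom g)).choose_spec)

/-- Objects over `S` whose structure maps are monomorphisms, each factoring through the later
ones, form a functor. -/
noncomputable def functorOfFactors (hE : AllMono E) {S : E} (X : J → E) (t : ∀ j, X j ⟶ S)
    (h : ∀ i j, i ≤ j → ∃ m : X i ⟶ X j, m ≫ t j = t i) : J ⥤ E :=
  functorOfUnique X (fun i j m => m ≫ t j = t i) h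
    (fun _ j _ _ hm hm' => (hE (t j)).right_cancellation _ _ (hm.trans hm'.symm))
    (by simp) (by intro i j k m m' _ _ hm hm'; simp [hm, hm'])

/-- The structure maps of `functorOfFactors` form a cocone. -/
noncomputable def coconeOfFactors (hE : AllMono E) {S : E} (X : J → E) (t : ∀ j, X j ⟶ S)
    (h : ∀ i j, i ≤ j → ∃ m : X i ⟶ X j, m ≫ t j = t i) :
    Cocone (functorOfFactors hE X t h) where
  pt := S
  ι :=
    { app := t
      naturality := fun i j f => (h i j (leOfHom f)).choose_spec.trans (Category.comp_id _).symm }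

end Thin

/-! ### Chains built by transfinite recursion -/

/-- A member of an initial segment of `Set.Iio o`, as a member of `Set.Iio o`. -/
abbrev raise {o : Ordinal.{w}} (j : Set.Iio o) (i : Set.Iio j.1) : Set.Iio o :=
  ⟨i.1, lt_trans (Set.mem_Iio.1 i.2) (Set.mem_Iio.1 j.2)⟩

theorem raise_lt {o : Ordinal.{w}} (j : Set.Iio o) (i : Set.Iio j.1) : raise j i < j :=
  i.2

/-- The inclusion of an initial segment of `Set.Iio o` given by one of its members. -/
abbrev initialIncl {o : Ordinal.{w}} (j : Set.Iio o) : Set.Iio j.1 ⥤ Set.Iio o :=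
  Monotone.functor (f := raise j)
    (fun _ _ h => h)

/-- The cocone given on an initial segment of a chain by a later member. -/
@[simps]
def initialCocone {o : Ordinal.{w}} {E : Type u} [Category.{v} E] (H : Chain o E)
    (j : Set.Iio o) : Cocone (initialIncl j ⋙ H) where
  pt := H.obj j
  ι :=
    { app := fun i => H.map (homOfLE (raise_lt j i).le)
      naturality := fun i i' f => by
        simp only [Functor.comp_map, Functor.const_obj_map, ← H.map_comp]
        exact (Category.comp_id _).symm }

/-- Transfinite construction of a chain, when chains on proper initial segments have cocones with
a prescribed property. -/
theorem exists_chain_of_exists_cocone {E : Type u} [Category.{v} E] [Nonempty E]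
    {o : Ordinal.{w}} (S : ∀ (j : Set.Iio o) (H : Chain j.1 E), Cocone H → Prop)
    (ext : ∀ (j : Set.Iio o) (H : Chain j.1 E), ∃ c : Cocone H, S j H c) :
    ∃ H : Chain o E, ∀ j, ∃ c : Cocone (initialIncl j ⋙ H), S j _ c ∧
      Nonempty (c ⟶ initialCocone H j) := by
  classical
  -- The datum at `j` records its object together with all maps into it from earlier objects;
  -- entries beyond `j` are junk. A transition map is thus part of the later datum, which makes it
  -- unique and turns functoriality into a relation between pairs of data.
  let T : Set.Iio o → Type (max (w + 1) u v) := fun j =>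
    {d : Σ X : E, Set.Iio o → Σ Z : E, (Z ⟶ X) // d.2 j = ⟨d.1, 𝟙 _⟩}
  let M : ∀ i j (d : T i) (d' : T j), (d.1.1 ⟶ d'.1.1) → Prop := fun i j d d' m =>
    d'.1.2 i = ⟨d.1.1, m⟩ ∧ ∀ k ≤ i, d'.1.2 k = ⟨(d.1.2 k).1, (d.1.2 k).2 ≫ m⟩
  have uniq : ∀ i j (d : T i) (d' : T j) m m', M i j d d' m → M i j d d' m' → m = m' := by
    intro i j d d' m m' h h'
    have := h.1.symm.trans h'.1
    simpa using this
  have hid : ∀ i (d : T i), M i i d d (𝟙 _) := fun i d => ⟨d.2, fun k _ => by simp⟩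
  have hcomp : ∀ i j k (d : T i) (d' : T j) (d'' : T k) m m', i ≤ j → M i j d d' m →
      M j k d' d'' m' → M i k d d'' (m ≫ m') := by
    intro i j k d d' d'' m m' hij h h'
    refine ⟨?_, fun l hl => ?_⟩
    · rw [h'.2 i hij, h.1]
    · rw [h'.2 l (hl.trans hij), h.2 l hl]
      simp
  let fn : ∀ (j : Set.Iio o) (p : ∀ i, i < j → T i)
      (_ : ∀ i i' (hi : i < j) (hi' : i' < j), i < i' → ∃ m, M i i' (p i hi) (p i' hi') m),
      Chain j.1 E := fun j p hp =>
    functorOfUnique (fun i : Set.Iio j.1 => (p (raise j i) i.2).1.1)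
      (fun i i' m => M (raise j i) (raise j i') (p _ i.2) (p _ i'.2) m)
      (fun i i' h => by
        rcases h.eq_or_lt with rfl | h
        · exact ⟨_, hid _ _⟩
        · exact hp (raise j i) (raise j i') i.2 i'.2 h)
      (fun _ _ _ _ h h' => uniq _ _ _ _ _ _ h h') (fun _ => hid _ _)
      (fun _ _ _ _ _ h _ h' h'' => hcomp _ _ _ _ _ _ _ _ h h' h'')
  have fn_map : ∀ j p hp (i i' : Set.Iio j.1) (f : i ⟶ i'),
      M (raise j i) (raise j i') (p _ i.2) (p _ i'.2)
        ((fn j p hp).map f) := fun j p hp i i' f => Exists.choose_spec _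
  have : ∀ j, Nonempty (T j) := fun j =>
    ⟨⟨⟨Classical.arbitrary E, fun _ => ⟨_, 𝟙 _⟩⟩, rfl⟩⟩
  obtain ⟨q, hq, hs⟩ := exists_coherent_family (T := T) (fun i j d d' => ∃ m, M i j d d' m)
    (fun j p x => ∀ hp, ∃ c : Cocone (fn j p hp), S j _ c ∧ ∃ e : c.pt ⟶ x.1.1,
      ∀ i : Set.Iio j.1, x.1.2 (raise j i) =
        ⟨(p (raise j i) i.2).1.1, c.ι.app i ≫ e⟩) (by
    intro j p hp
    obtain ⟨c, hc⟩ := ext j (fn j p hp)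
    let x : T j := ⟨⟨c.pt, fun i => if h : i < j then
      ⟨(p i h).1.1, c.ι.app ⟨i.1, h⟩⟩ else ⟨_, 𝟙 _⟩⟩, by simp⟩
    have hx : ∀ i (h : i < j), x.1.2 i = ⟨(p i h).1.1, c.ι.app ⟨i.1, h⟩⟩ := fun i h => by
      simp [x, h]
    refine ⟨x, fun i hi => ⟨c.ι.app ⟨i.1, hi⟩, hx i hi, fun k hk => ?_⟩, fun _ =>
      ⟨c, hc, 𝟙 _, fun i => (hx (raise j i) i.2).trans (by erw [Category.comp_id])⟩⟩
    rw [hx k (hk.trans_lt hi)]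
    have h1 := fn_map j p hp ⟨k.1, hk.trans_lt hi⟩ ⟨i.1, hi⟩ (homOfLE hk)
    have h2 := c.w (homOfLE hk : (⟨k.1, hk.trans_lt hi⟩ : Set.Iio j.1) ⟶ ⟨i.1, hi⟩)
    have h3 : (p i hi).1.2 k = _ := h1.1
    rw [h3, ← h2]
    rfl)
  let H : Chain o E := functorOfUnique (fun i => (q i).1.1)
      (fun i i' m => M i i' (q i) (q i') m)
      (fun i i' h => by
        rcases h.eq_or_lt with rfl | h
        · exact ⟨_, hid _ _⟩
        · exact hq _ _ h)
      (fun _ _ _ _ h h' => uniq _ _ _ _ _ _ h h') (fun _ => hid _ _)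
      (fun _ _ _ _ _ h _ h' h'' => hcomp _ _ _ _ _ _ _ _ h h' h'')
  have H_map : ∀ {i i'} (f : i ⟶ i'), M i i' (q i) (q i') (H.map f) :=
    fun f => Exists.choose_spec _
  refine ⟨H, fun j => ?_⟩
  obtain ⟨c, hc, e, he⟩ := hs j (fun i i' _ _ h => hq i i' h)
  refine ⟨c, hc, ⟨⟨e, fun i => ?_⟩⟩⟩
  have h1 := (H_map (homOfLE (raise_lt j i).le)).1
  exact eq_of_heq (Sigma.mk.inj_iff.1 ((he i).symm.trans h1)).2

/-! ### Regularity and bookkeeping -/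

section Regular

variable {κ : Cardinal.{w}}

/-- Fewer than `κ` ordinals below the regular cardinal `κ` are bounded below `κ`. -/
theorem exists_upper_bound (hκ : κ.IsRegular) {μ : Ordinal.{w}} (hμ : μ < κ.ord)
    (f : Set.Iio μ → Set.Iio κ.ord) : ∃ b, ∀ i, f i ≤ b := by
  refine ⟨⟨⨆ i, (f i).1, ?_⟩, fun i => Ordinal.le_iSup (fun i => (f i).1) i⟩
  refine Ordinal.lift_iSup_lt_of_lt_cof ?_ fun i => (f i).2
  rw [Cardinal.mk_Iio_ordinal, ← Ordinal.lift_cof, hκ.cof_ord]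
  exact (Cardinal.lift_lift _).trans_lt (Cardinal.lift_lt.{w, w + 1}.2 (Cardinal.lt_ord.1 hμ))

/-- Bookkeeping: every pair is enumerated after its first component. -/
theorem exists_bookkeeping (hκ : κ.IsRegular) :
    ∃ φ : Set.Iio κ.ord → Set.Iio κ.ord × Set.Iio κ.ord, ∀ i t, ∃ j, i < j ∧ φ j = (i, t) := by
  have hJ : Cardinal.mk (Set.Iio κ.ord) = Cardinal.lift.{w + 1} κ := by
    rw [Cardinal.mk_Iio_ordinal, Cardinal.card_ord]
  have hinf : Cardinal.aleph0 ≤ Cardinal.mk (Set.Iio κ.ord) := by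
    rw [hJ]; simpa using hκ.aleph0_le
  have h3 : Cardinal.mk (Set.Iio κ.ord) =
      Cardinal.mk ((Set.Iio κ.ord × Set.Iio κ.ord) × Set.Iio κ.ord) := by
    simp only [Cardinal.mk_prod, Cardinal.lift_id]
    rw [Cardinal.mul_eq_self hinf, Cardinal.mul_eq_self hinf]
  -- The third factor makes every pair occur `κ` times, too often for all occurrences to lie at or
  -- below `i`.
  obtain ⟨e⟩ := Cardinal.eq.1 h3
  refine ⟨fun j => (e j).1, fun i t => ?_⟩
  by_contra! hcon
  have hle : ∀ s, e.symm ((i, t), s) ≤ i := fun s => by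
    by_contra hlt
    exact hcon _ (not_le.1 hlt) (by simp)
  have hi : Order.succ i.1 < κ.ord := (Cardinal.isSuccLimit_ord hκ.aleph0_le).succ_lt i.2
  let g : Set.Iio κ.ord → Set.Iio (Order.succ i.1) := fun s =>
    ⟨(e.symm ((i, t), s)).1, Order.lt_succ_of_le (Subtype.coe_le_coe.2 (hle s))⟩
  have hg : Function.Injective g := fun s s' h => by
    have : e.symm ((i, t), s) = e.symm ((i, t), s') := Subtype.ext (congrArg (·.1) h)
    simpa using this
  have := Cardinal.mk_le_of_injective hg
  rw [hJ, Cardinal.mk_Iio_ordinal, Cardinal.lift_le] at this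
  exact absurd (Cardinal.lt_ord.1 hi) this.not_gt

end Regular

/-! ### Fraïssé theory over a base of small objects -/

section Abstract

variable {κ : Cardinal.{w}} {D : Type u} [Category.{v} D] {P : ObjectProperty D}

/-- Any two objects satisfying `P` embed into a common one. -/
def JointEmbedding (P : ObjectProperty D) : Prop :=
  ∀ X Y : D, P X → P Y → ∃ (Z : D) (_ : X ⟶ Z) (_ : Y ⟶ Z), P Z

/-- Spans of objects satisfying `P` can be amalgamated within `P`. -/
def Amalgamation (P : ObjectProperty D) : Prop :=
  ∀ (X Y Z : D) (f : X ⟶ Y) (g : X ⟶ Z), P X → P Y → P Z →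
    ∃ (W : D) (f' : Z ⟶ W) (g' : Y ⟶ W), P W ∧ f ≫ g' = g ≫ f'

/-- The objects satisfying `P` behave like the `κ`-small objects of a semi-`κ`-algebroidal
category all of whose morphisms are monomorphisms. -/
structure IsSmallBase (κ : Cardinal.{w}) (P : ObjectProperty D) : Prop where
  allMono : AllMono D
  exists_colimit : ∀ μ : Ordinal.{w}, 0 < μ → μ < κ.ord → ∀ H : Chain μ D, (∀ i, P (H.obj i)) →
    ∃ c : Cocone H, Nonempty (IsColimit c) ∧ P c.pt
  hasColimit : ∀ H : Chain κ.ord D, (∀ i, P (H.obj i)) → HasColimit H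
  exists_factor : ∀ (H : Chain κ.ord D) (c : Cocone H), (∀ i, P (H.obj i)) →
    Nonempty (IsColimit c) → ∀ X, P X → ∀ h : X ⟶ c.pt,
      ∃ (j : Set.Iio κ.ord) (g : X ⟶ H.obj j), g ≫ c.ι.app j = h
  exists_chain : ∀ X : D, ∃ H : Chain κ.ord D, (∀ i, P (H.obj i)) ∧
    ∃ t : H ⟶ (Functor.const (Set.Iio κ.ord)).obj X, Nonempty (IsColimit (Cocone.mk X t))

/-- At most `κ` morphisms out of an object satisfying `P` dominate all of them. -/
def HasDominatingMaps (κ : Cardinal.{w}) (P : ObjectProperty D) : Prop :=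
  ∀ X, P X → ∃ e : Set.Iio κ.ord → Σ Y : D, (X ⟶ Y), (∀ t, P (e t).1) ∧
    ∀ Y, P Y → ∀ g : X ⟶ Y, ∃ (t : Set.Iio κ.ord) (m : Y ⟶ (e t).1), g ≫ m = (e t).2

/-- Every morphism from an object satisfying `P` to `U` extends along morphisms of objects
satisfying `P`. -/
def IsSaturated (P : ObjectProperty D) (U : D) : Prop :=
  ∀ (X Y : D) (f : X ⟶ U) (g : X ⟶ Y), P X → P Y → ∃ y : Y ⟶ U, g ≫ y = f

namespace IsSmallBase

/-- A monomorphism with a section of it is an isomorphism. -/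
theorem isIso_of_section (hD : AllMono D) {X Y : D} (f : X ⟶ Y) (g : Y ⟶ X) (h : g ≫ f = 𝟙 Y) :
    IsIso f :=
  have := hD f
  ⟨g, by rw [← cancel_mono f, Category.assoc, h]; simp, h⟩

variable (hP : IsSmallBase κ P)

include hP

theorem exists_isColimit (X : D) : ∃ (H : Chain κ.ord D) (c : Cocone H) (_ : IsColimit c),
    c.pt = X ∧ ∀ i, P (H.obj i) := by
  obtain ⟨H, hH, t, ⟨ht⟩⟩ := hP.exists_chain X
  exact ⟨H, _, ht, rfl, hH⟩

/-- A colimit of an arbitrary `κ`-chain is the colimit of a diagonal chain of objects satisfying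
`P`. -/
theorem isSmall (hκ : κ.IsRegular) {X : D} (hX : P X) : IsSmall κ D X := by
  rintro H c ⟨hc⟩ h
  have hmono := hP.allMono
  choose K hK t ht using fun i => hP.exists_chain (H.obj i)
  -- A diagonal through the chains `K i`: the index `k j` is so large that `(K j).obj (k j)`
  -- receives the earlier diagonal members and every `(K i).obj k` with `i, k < j`. These are fewer
  -- than `κ` demands, so regularity bounds them.
  obtain ⟨k, hr, hs⟩ := exists_coherent_family (J := Set.Iio κ.ord) (T := fun _ => Set.Iio κ.ord)
    (hT := fun j => ⟨j⟩)
    (fun i j ki kj => ∀ h : i ≤ j, ∃ m : (K i).obj ki ⟶ (K j).obj kj,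
      m ≫ (t j).app kj = (t i).app ki ≫ H.map (homOfLE h))
    (fun j _ x => ∀ i (h : i < j) k, k < j → ∃ m : (K i).obj k ⟶ (K j).obj x,
      m ≫ (t j).app x = (t i).app k ≫ H.map (homOfLE h.le)) (by
    intro j p _
    have fac : ∀ (i) (h : i < j) (k), ∃ b, ∀ x, b ≤ x → ∃ m : (K i).obj k ⟶ (K j).obj x,
        m ≫ (t j).app x = (t i).app k ≫ H.map (homOfLE h.le) := by
      intro i h k
      obtain ⟨b, m, hm⟩ := hP.exists_factor (K j) _ (hK j) (ht j) _ (hK i k)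
        ((t i).app k ≫ H.map (homOfLE h.le))
      refine ⟨b, fun x hx => ⟨m ≫ (K j).map (homOfLE hx), ?_⟩⟩
      rw [Category.assoc, ← hm, (t j).naturality]
      simp
    choose β hβ using fac
    obtain ⟨b₁, hb₁⟩ := exists_upper_bound hκ j.2
      (fun i : Set.Iio j.1 => β (raise j i) i.2 (p (raise j i) i.2))
    choose b₂ hb₂ using fun i : Set.Iio j.1 => exists_upper_bound hκ j.2
      (fun k : Set.Iio j.1 => β (raise j i) i.2 (raise j k))
    obtain ⟨b₃, hb₃⟩ := exists_upper_bound hκ j.2 b₂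
    refine ⟨max b₁ b₃, fun i hi _ => hβ i hi _ _ ?_, fun i hi k hk => hβ i hi _ _ ?_⟩
    · exact (hb₁ ⟨i.1, hi⟩).trans (le_max_left _ _)
    · exact ((hb₂ ⟨i.1, hi⟩ ⟨k.1, hk⟩).trans (hb₃ _)).trans (le_max_right _ _))
  let τ : ∀ j, (K j).obj (k j) ⟶ c.pt := fun j => (t j).app (k j) ≫ c.ι.app j
  have hτ : ∀ i j, i ≤ j → ∃ m : (K i).obj (k i) ⟶ (K j).obj (k j), m ≫ τ j = τ i := by
    intro i j hij
    rcases hij.eq_or_lt with rfl | hlt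
    · exact ⟨𝟙 _, Category.id_comp _⟩
    · obtain ⟨m, hm⟩ := hr i j hlt hij
      exact ⟨m, by simp [τ, reassoc_of% hm]⟩
  let N := functorOfFactors hmono _ τ hτ
  have hN : ∀ i, P (N.obj i) := fun i => hK i _
  have := hP.hasColimit N hN
  let w : colimit N ⟶ c.pt := colimit.desc N (coconeOfFactors hmono _ τ hτ)
  have hw : ∀ j, colimit.ι N j ≫ w = τ j := fun j => colimit.ι_desc _ _
  have hwm := hmono w
  have h₁ : ∀ i k, ∃ n : (K i).obj k ⟶ colimit N, n ≫ w = (t i).app k ≫ c.ι.app i := by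
    intro i k
    -- Bookkeeping serves here only to supply an index beyond `max i k`.
    obtain ⟨φ, hφ⟩ := exists_bookkeeping hκ
    obtain ⟨j, hj, -⟩ := hφ (max i k) i
    obtain ⟨m, hm⟩ := hs j i ((le_max_left _ _).trans_lt hj) k ((le_max_right _ _).trans_lt hj)
    exact ⟨m ≫ colimit.ι N j, (Category.assoc _ _ _).trans ((congrArg (m ≫ ·) (hw j)).trans
      (by simp [τ, reassoc_of% hm]))⟩
  choose n hn using h₁
  have h₂ : ∀ i, ∃ n : H.obj i ⟶ colimit N, n ≫ w = c.ι.app i := by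
    intro i
    refine ⟨(ht i).some.desc ⟨_, ⟨n i, fun k l f => ?_⟩⟩, (ht i).some.hom_ext fun k => ?_⟩
    · rw [← cancel_mono w, Category.assoc, hn, ← Category.assoc, (t i).naturality]
      simp [hn]
    · exact ((ht i).some.fac_assoc _ _ _).trans (hn i k)
  choose n' hn' using h₂
  let v : c.pt ⟶ colimit N := hc.desc ⟨_, ⟨n', fun k l f => by
    rw [← cancel_mono w, Category.assoc, hn']
    simp [hn']⟩⟩
  have hv : v ≫ w = 𝟙 _ := hc.hom_ext fun i =>
    (hc.fac_assoc _ _ _).trans ((hn' i).trans (Category.comp_id _).symm)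
  -- The map `h` is moved by `v` to the colimit of the diagonal chain, where factorization is known,
  -- and brought back by `w`.
  obtain ⟨j, g, hg⟩ := hP.exists_factor N _ hN ⟨colimit.isColimit N⟩ X hX (h ≫ v)
  refine ⟨j, g ≫ (t j).app (k j), ?_⟩
  have := congrArg (· ≫ w) hg
  simp only [Category.assoc, hv, Category.comp_id] at this
  rw [← this]
  exact (Category.assoc _ _ _).trans (congrArg (g ≫ ·) (hw j).symm)

/-- The identity of `X` factors through a member of a chain of `P`-objects with colimit `X`; the
corresponding leg is monic and has a section. -/
theorem exists_iso {X : D} (hX : IsSmall κ D X) :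
    ∃ Y, P Y ∧ Nonempty (Y ≅ X) := by
  obtain ⟨H, c, hc, rfl, hH⟩ := hP.exists_isColimit X
  obtain ⟨j, g, hg⟩ := hX H c ⟨hc⟩ (𝟙 _)
  have := isIso_of_section hP.allMono (c.ι.app j) g hg
  exact ⟨_, hH j, ⟨asIso (c.ι.app j)⟩⟩

/-- Two morphisms from objects satisfying `P` factor through a common member of the chain. -/
theorem exists_factor₂ {H : Chain κ.ord D} {c : Cocone H} (hH : ∀ i, P (H.obj i))
    (hc : IsColimit c) {X Y : D} (hX : P X) (hY : P Y) (f : X ⟶ c.pt) (g : Y ⟶ c.pt) :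
    ∃ (j : Set.Iio κ.ord) (f' : X ⟶ H.obj j) (g' : Y ⟶ H.obj j),
      f' ≫ c.ι.app j = f ∧ g' ≫ c.ι.app j = g := by
  obtain ⟨i, f', rfl⟩ := hP.exists_factor H c hH ⟨hc⟩ X hX f
  obtain ⟨j, g', rfl⟩ := hP.exists_factor H c hH ⟨hc⟩ Y hY g
  exact ⟨max i j, f' ≫ H.map (homOfLE (le_max_left i j)), g' ≫ H.map (homOfLE (le_max_right i j)),
    by simp, by simp⟩

theorem jointEmbedding {U : D} (hU : IsUniversal ⊤ U) : JointEmbedding P := by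
  intro X Y hX hY
  obtain ⟨f⟩ := hU X trivial
  obtain ⟨g⟩ := hU Y trivial
  obtain ⟨H, c, hc, rfl, hH⟩ := hP.exists_isColimit U
  obtain ⟨j, f', g', -, -⟩ := hP.exists_factor₂ hH hc hX hY f g
  exact ⟨_, f', g', hH j⟩

/-- An automorphism of `U` makes the two composites from `X` agree, so the span is completed in `U`.
Both maps then factor through one member of a chain, whose leg is monic, so the square already
commutes there. -/
theorem amalgamation (hκ : κ.IsRegular) {U : D} (hU : IsUniversal ⊤ U)
    (hh : IsHomogeneous (IsSmall κ D) U) : Amalgamation P := by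
  intro X Y Z f g hX hY hZ
  obtain ⟨a⟩ := hU Y trivial
  obtain ⟨b⟩ := hU Z trivial
  obtain ⟨h, hfg⟩ := hh X (hP.isSmall hκ hX) (f ≫ a) (g ≫ b)
  obtain ⟨H, c, hc, rfl, hH⟩ := hP.exists_isColimit U
  obtain ⟨j, f', g', hf, hg⟩ := hP.exists_factor₂ hH hc hY hZ (a ≫ h.hom) b
  refine ⟨_, g', f', hH j, ?_⟩
  have := hP.allMono (c.ι.app j)
  rw [← cancel_mono (c.ι.app j), Category.assoc, Category.assoc, hf, hg, ← hfg, Category.assoc]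

/-- The limit of a Fraïssé sequence. -/
theorem exists_isSaturated (hκ : κ.IsRegular) (hdom : HasDominatingMaps κ P)
    (hne : Nonempty D) (hA : Amalgamation P) :
    ∃ U : D, IsSaturated P U := by
  have h0 : (0 : Ordinal.{w}) < κ.ord := Cardinal.ord_pos.2 hκ.pos
  obtain ⟨X₀, hX₀⟩ : ∃ X, P X := by
    obtain ⟨H, c, hc, -, hH⟩ := hP.exists_isColimit hne.some
    exact ⟨_, hH ⟨0, h0⟩⟩
  have : Nonempty P.FullSubcategory := ⟨⟨X₀, hX₀⟩⟩
  obtain ⟨φ, hφ⟩ := exists_bookkeeping hκ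
  choose e he hdom using fun X : P.FullSubcategory => hdom X.1 X.2
  -- Stage `j` handles the single task `φ j = (i, t)`: absorb the `t`-th dominating map out of the
  -- `i`-th member, provided `i < j`. The colimit of the earlier stages is amalgamated with the
  -- target of that map.
  obtain ⟨H, hH⟩ := exists_chain_of_exists_cocone (E := P.FullSubcategory) (o := κ.ord)
    (fun j H c => ∀ (i : Set.Iio j.1) t, φ j = (raise j i, t) →
      ∃ y : (e (H.obj i) t).1 ⟶ c.pt.1, (e (H.obj i) t).2 ≫ y = (c.ι.app i).hom) (by
    intro j H
    -- The empty chain need not have a colimit, so the construction starts at `X₀`.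
    by_cases hj : 0 < j.1
    swap
    · have : IsEmpty (Set.Iio j.1) := ⟨fun i => hj ((zero_le).trans_lt (Set.mem_Iio.1 i.2))⟩
      exact ⟨⟨⟨X₀, hX₀⟩, ⟨isEmptyElim, fun {i} => isEmptyElim i⟩⟩, isEmptyElim⟩
    obtain ⟨c, -, hcP⟩ := hP.exists_colimit j.1 hj j.2 (H ⋙ P.ι) (fun i => (H.obj i).2)
    by_cases hi : (φ j).1 < j
    · let i : Set.Iio j.1 := ⟨(φ j).1.1, hi⟩
      obtain ⟨W, f, g, hW, hfg⟩ := hA _ _ _ (c.ι.app i) (e (H.obj i) (φ j).2).2 (H.obj i).2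
        hcP (he _ _)
      refine ⟨⟨⟨W, hW⟩, ⟨fun k => P.homMk (c.ι.app k ≫ g), fun k l m => ?_⟩⟩, ?_⟩
      · ext
        have := c.w m
        dsimp at this ⊢
        simp [← this]
      · intro i' t hi'
        obtain rfl : i = i' := Subtype.ext (congrArg (·.1.1) hi')
        obtain rfl : (φ j).2 = t := congrArg (·.2) hi'
        exact ⟨f, hfg.symm⟩
    · refine ⟨⟨⟨c.pt, hcP⟩, ⟨fun k => P.homMk (c.ι.app k), fun k l m => ?_⟩⟩, ?_⟩
      · ext
        simpa using c.w m
      · intro i' t hi'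
        rw [hi'] at hi
        exact (hi (raise_lt j i')).elim)
  have absorb : ∀ (i : Set.Iio κ.ord) (Y : D), P Y → ∀ g : (H.obj i).1 ⟶ Y,
      ∃ (j : Set.Iio κ.ord) (hij : i ≤ j) (y : Y ⟶ (H.obj j).1),
        g ≫ y = (H.map (homOfLE hij)).hom := by
    intro i Y hY g
    obtain ⟨t, m, hm⟩ := hdom _ Y hY g
    obtain ⟨j, hij, hj⟩ := hφ i t
    obtain ⟨c, hc, ⟨a⟩⟩ := hH j
    obtain ⟨y, hy⟩ := hc ⟨i.1, hij⟩ t hj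
    have ha := congrArg (·.hom) (a.w ⟨i.1, hij⟩)
    refine ⟨j, hij.le, m ≫ y ≫ a.hom.hom, ?_⟩
    rw [reassoc_of% hm]
    exact (reassoc_of% hy) _ |>.trans ha
  have := hP.hasColimit (H ⋙ P.ι) (fun i => (H.obj i).2)
  refine ⟨colimit (H ⋙ P.ι), fun X Y f g hX hY => ?_⟩
  obtain ⟨i, f', rfl⟩ := hP.exists_factor _ _ (fun i => (H.obj i).2) ⟨colimit.isColimit (H ⋙ P.ι)⟩
    X hX f
  -- Amalgamating `f'` with `g` turns the extension problem into one starting at a member of the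
  -- chain, which a later member absorbs.
  obtain ⟨W, a, b, hW, hab⟩ := hA _ _ _ f' g hX (H.obj i).2 hY
  obtain ⟨j, hij, y, hy⟩ := absorb i W hW b
  refine ⟨a ≫ y ≫ colimit.ι (H ⋙ P.ι) j, ?_⟩
  rw [← reassoc_of% hab, reassoc_of% hy]
  congr 1
  exact colimit.w (H ⋙ P.ι) (homOfLE hij)

/-- A cocone from a chain of `P`-objects to `U` is built member by member. The chain need not be
continuous: the maps already chosen induce one on the colimit of the earlier members, and saturation
extends it to the next member. Joint embedding with a `P`-object over `U` starts the process. -/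
theorem isUniversal_of_isSaturated (hκ : κ.IsRegular) (hJ : JointEmbedding P) {U : D}
    (hU : IsSaturated P U) : IsUniversal ⊤ U := by
  intro X _
  have hUP : ∀ Y, P Y → Nonempty (Y ⟶ U) := by
    intro Y hY
    obtain ⟨H, c, hc, rfl, hH⟩ := hP.exists_isColimit U
    let o : Set.Iio κ.ord := ⟨0, Cardinal.ord_pos.2 hκ.pos⟩
    obtain ⟨Z, f, g, hZ⟩ := hJ _ Y (hH o) hY
    obtain ⟨y, -⟩ := hU _ Z (c.ι.app o) f (hH o) hZ
    exact ⟨g ≫ y⟩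
  obtain ⟨H, c, hc, rfl, hH⟩ := hP.exists_isColimit X
  obtain ⟨p, hp, -⟩ := exists_coherent_family (T := fun j => H.obj j ⟶ U)
    (hT := fun j => hUP _ (hH j))
    (fun i j a b => ∀ h : i ≤ j, H.map (homOfLE h) ≫ b = a) (fun _ _ _ => True) (by
    intro j p hp
    by_cases hj : 0 < j.1
    swap
    · exact ⟨(hUP _ (hH j)).some, fun i hi => (hj ((zero_le).trans_lt hi)).elim, trivial⟩
    obtain ⟨c', ⟨hc'⟩, hcP⟩ := hP.exists_colimit j.1 hj j.2 (initialIncl j ⋙ H) (fun i => hH _)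
    let t : Cocone (initialIncl j ⋙ H) := ⟨U, ⟨fun i => p (raise j i) i.2, fun i i' f => by
      rcases (leOfHom f).eq_or_lt with rfl | h
      · obtain rfl : f = 𝟙 _ := Subsingleton.elim _ _
        exact (congrArg (· ≫ p (raise j i) i.2) (H.map_id _)).trans
          ((Category.id_comp _).trans (Category.comp_id _).symm)
      · exact (hp (raise j i) (raise j i') i.2 i'.2 h (leOfHom f)).trans (Category.comp_id _).symm⟩⟩
    obtain ⟨y, hy⟩ := hU _ _ (hc'.desc t) (hc'.desc (initialCocone H j)) hcP (hH j)
    refine ⟨y, fun i hi _ => ?_, trivial⟩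
    have := congrArg (c'.ι.app ⟨i.1, hi⟩ ≫ ·) hy
    simp only [hc'.fac, hc'.fac_assoc] at this
    exact this)
  exact ⟨hc.desc ⟨U, ⟨p, fun i j f => by
    rcases (leOfHom f).eq_or_lt with rfl | h
    · obtain rfl : f = 𝟙 _ := Subsingleton.elim _ _
      simp
    · exact (hp i j h (leOfHom f)).trans (Category.comp_id _).symm⟩⟩⟩

/-- A partial self-embedding of a saturated object extends to one with a prescribed domain. -/
theorem exists_extension {U : D} (hU : IsSaturated P U) {Y Z : D} (hY : P Y) (hZ : P Z)
    (f g : Z ⟶ U) (u : Y ⟶ U) : ∃ (W : D) (f' g' : W ⟶ U) (m : Z ⟶ W) (a : Y ⟶ W),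
      P W ∧ m ≫ f' = f ∧ m ≫ g' = g ∧ a ≫ f' = u := by
  obtain ⟨H, c, hc, rfl, hH⟩ := hP.exists_isColimit U
  obtain ⟨j, a, m, ha, hm⟩ := hP.exists_factor₂ hH hc hY hZ u f
  obtain ⟨g', hg⟩ := hU _ _ g m hZ (hH j)
  exact ⟨_, c.ι.app j, g', m, a, hH j, hm, hg, ha⟩

omit hP in
/-- A second cocone over the functor of `functorOfFactors`. -/
noncomputable def coconeOfFactors₂ (hD : AllMono D) {J : Type*} [Preorder J] {S S' : D} (X : J → D)
    (f : ∀ j, X j ⟶ S) (g : ∀ j, X j ⟶ S')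
    (h : ∀ i j, i ≤ j → ∃ m : X i ⟶ X j, m ≫ f j = f i ∧ m ≫ g j = g i) :
    Cocone (functorOfFactors hD X f fun i j hij => (h i j hij).imp fun _ => And.left) where
  pt := S'
  ι :=
    { app := g
      naturality := fun i j k => by
        obtain ⟨m, hm, hm'⟩ := h i j (leOfHom k)
        have := hD (f j)
        have h₁ := (coconeOfFactors hD X f fun i j hij => (h i j hij).imp fun _ => And.left).w k
        obtain rfl : _ = m := (cancel_mono (f j)).1 (h₁.trans hm.symm)
        exact hm'.trans (Category.comp_id _).symm }

/-- Back-and-forth: a `P`-object with two maps to `U` is a partial isomorphism of `U`. An increasing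
chain of these is built from `(X, f, g)` so that every member of a chain for `U` factors through
both legs; both induced maps from the colimit to `U` are then invertible. -/
theorem isHomogeneous_of_isSaturated (hκ : κ.IsRegular) {U : D} (hU : IsSaturated P U) :
    IsHomogeneous P U := by
  intro X hX f g
  have hmono := hP.allMono
  have h0 : (0 : Ordinal.{w}) < κ.ord := Cardinal.ord_pos.2 hκ.pos
  obtain ⟨K, c, hc, hcU, hK⟩ := hP.exists_isColimit U
  subst hcU
  let Q := Σ Z : D, (Z ⟶ c.pt) × (Z ⟶ c.pt)
  let le : Q → Q → Prop := fun q q' => ∃ m : q.1 ⟶ q'.1, m ≫ q'.2.1 = q.2.1 ∧ m ≫ q'.2.2 = q.2.2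
  have hle : ∀ q, le q q := fun q => ⟨𝟙 _, by simp, by simp⟩
  have htrans : ∀ q q' q'', le q q' → le q' q'' → le q q'' := by
    rintro q q' q'' ⟨m, h₁, h₂⟩ ⟨m', h₃, h₄⟩
    exact ⟨m ≫ m', by rw [Category.assoc, h₃, h₁], by rw [Category.assoc, h₄, h₂]⟩
  let q₀ : Q := ⟨X, f, g⟩
  let R := {q : Q // P q.1 ∧ le q₀ q}
  obtain ⟨q, hr, hs⟩ := exists_coherent_family (J := Set.Iio κ.ord) (T := fun _ => R)
    (hT := fun _ => ⟨⟨q₀, hX, hle _⟩⟩) (fun _ _ q q' => le q.1 q'.1)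
    (fun j _ q => (∃ a : K.obj j ⟶ q.1.1, a ≫ q.1.2.1 = c.ι.app j) ∧
      ∃ b : K.obj j ⟶ q.1.1, b ≫ q.1.2.2 = c.ι.app j) (by
    intro j p hp
    have bound : ∃ x : R, ∀ i (hi : i < j), le (p i hi).1 x.1 := by
      by_cases hj : 0 < j.1
      swap
      · exact ⟨⟨q₀, hX, hle _⟩, fun i hi => (hj ((zero_le).trans_lt hi)).elim⟩
      let q : Set.Iio j.1 → R := fun i => p (raise j i) i.2
      have hq : ∀ i i', i ≤ i' → le (q i).1 (q i').1 := by
        intro i i' h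
        rcases h.eq_or_lt with rfl | h
        · exact hle _
        · exact hp (raise j i) (raise j i') i.2 i'.2 h
      let t₁ := coconeOfFactors hmono (fun i => (q i).1.1) (fun i => (q i).1.2.1)
        (fun i j hij => (hq i j hij).imp fun _ => And.left)
      -- The functor is determined by the first legs. The second legs also form a cocone on it,
      -- because factorizations through the monic first legs are unique.
      let t₂ := coconeOfFactors₂ hmono (fun i => (q i).1.1) (fun i => (q i).1.2.1)
        (fun i => (q i).1.2.2) hq
      obtain ⟨d, ⟨hd⟩, hdP⟩ := hP.exists_colimit j.1 hj j.2
        (functorOfFactors hmono (fun i => (q i).1.1) (fun i => (q i).1.2.1)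
          (fun i j hij => (hq i j hij).imp fun _ => And.left)) (fun i => (q i).2.1)
      have hqd : ∀ i, le (q i).1 ⟨d.pt, hd.desc t₁, hd.desc t₂⟩ :=
        fun i => ⟨d.ι.app i, hd.fac t₁ i, hd.fac t₂ i⟩
      exact ⟨⟨⟨d.pt, hd.desc t₁, hd.desc t₂⟩, hdP,
        htrans _ _ _ (q ⟨0, hj⟩).2.2 (hqd ⟨0, hj⟩)⟩, fun i hi => hqd ⟨i.1, hi⟩⟩
    obtain ⟨x, hx⟩ := bound
    obtain ⟨W, f₁, g₁, m₁, a, hW, h₁, h₂, h₃⟩ :=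
      hP.exists_extension hU (hK j) x.2.1 x.1.2.1 x.1.2.2 (c.ι.app j)
    -- The same extension with the legs exchanged puts `K.obj j` under the second leg too.
    obtain ⟨W', g', f', m', b, hW', h₁', h₂', h₃'⟩ :=
      hP.exists_extension hU (hK j) hW g₁ f₁ (c.ι.app j)
    have hx' : le x.1 ⟨W', f', g'⟩ := ⟨m₁ ≫ m', by simp [h₂', h₁], by simp [h₁', h₂]⟩
    exact ⟨⟨⟨W', f', g'⟩, hW', htrans _ _ _ x.2.2 hx'⟩, fun i hi => htrans _ _ _ (hx i hi) hx',
      ⟨a ≫ m', by simp [h₂', h₃]⟩, ⟨b, h₃'⟩⟩)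
  have hq : ∀ i j, i ≤ j → le (q i).1 (q j).1 := by
    intro i j h
    rcases h.eq_or_lt with rfl | h
    · exact hle _
    · exact hr i j h
  let t₁ := coconeOfFactors hmono (fun i => (q i).1.1) (fun i => (q i).1.2.1)
    (fun i j hij => (hq i j hij).imp fun _ => And.left)
  let t₂ := coconeOfFactors₂ hmono (fun i => (q i).1.1) (fun i => (q i).1.2.1)
    (fun i => (q i).1.2.2) hq
  let N := functorOfFactors hmono (fun i => (q i).1.1) (fun i => (q i).1.2.1)
    (fun i j hij => (hq i j hij).imp fun _ => And.left)
  have := hP.hasColimit N (fun i => (q i).2.1)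
  have iso : ∀ v : colimit N ⟶ c.pt, (∀ j, ∃ a : K.obj j ⟶ N.obj j,
      a ≫ colimit.ι N j ≫ v = c.ι.app j) → IsIso v := by
    intro v hv
    have := hmono v
    choose a ha using hv
    refine isIso_of_section hmono v (hc.desc ⟨_, ⟨fun j => a j ≫ colimit.ι N j, fun i j k => ?_⟩⟩)
      (hc.hom_ext fun j => ?_)
    · rw [← cancel_mono v]
      simp [ha]
    · rw [hc.fac_assoc]
      simp [ha]
  obtain ⟨v₁, h₁⟩ : ∃ v : colimit N ⟶ c.pt, ∀ j, colimit.ι N j ≫ v = (q j).1.2.1 :=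
    ⟨_, colimit.ι_desc t₁⟩
  obtain ⟨v₂, h₂⟩ : ∃ v : colimit N ⟶ c.pt, ∀ j, colimit.ι N j ≫ v = (q j).1.2.2 :=
    ⟨_, colimit.ι_desc t₂⟩
  have i₁ : IsIso v₁ := iso _ fun j => by
    obtain ⟨a, ha⟩ := (hs j).1
    exact ⟨a, (congrArg (a ≫ ·) (h₁ j)).trans ha⟩
  have i₂ : IsIso v₂ := iso _ fun j => by
    obtain ⟨a, ha⟩ := (hs j).2
    exact ⟨a, (congrArg (a ≫ ·) (h₂ j)).trans ha⟩
  refine ⟨(asIso v₁).symm ≪≫ asIso v₂, ?_⟩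
  obtain ⟨m, hm₁, hm₂⟩ := (q ⟨0, h0⟩).2.2
  obtain ⟨n, e₁, e₂⟩ : ∃ n : X ⟶ colimit N, n ≫ v₁ = f ∧ n ≫ v₂ = g :=
    ⟨m ≫ colimit.ι N _, (Category.assoc _ _ _).trans ((congrArg (m ≫ ·) (h₁ _)).trans hm₁),
      (Category.assoc _ _ _).trans ((congrArg (m ≫ ·) (h₂ _)).trans hm₂)⟩
  rw [← e₁, ← e₂]
  simp

theorem exists_isUniversal_isHomogeneous_iff (hκ : κ.IsRegular) (hdom : HasDominatingMaps κ P)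
    (hne : Nonempty D) :
    (∃ U : D, IsUniversal ⊤ U ∧ IsHomogeneous (IsSmall κ D) U) ↔
      JointEmbedding P ∧ Amalgamation P := by
  constructor
  · rintro ⟨U, hU, hh⟩
    exact ⟨hP.jointEmbedding hU, hP.amalgamation hκ hU hh⟩
  · rintro ⟨hJ, hA⟩
    obtain ⟨U, hU⟩ := hP.exists_isSaturated hκ hdom hne hA
    refine ⟨U, hP.isUniversal_of_isSaturated hκ hJ hU, fun X hX f g => ?_⟩
    -- Homogeneity is known for `P`-objects, so the small object is replaced by an isomorphic one in
    -- `P`.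
    obtain ⟨Y, hY, ⟨i⟩⟩ := hP.exists_iso hX
    obtain ⟨h, hh⟩ := hP.isHomogeneous_of_isSaturated hκ hU Y hY (i.hom ≫ f) (i.hom ≫ g)
    exact ⟨h, by simpa using hh⟩

end IsSmallBase

end Abstract

/-! ### Cardinal estimates and short colimits of small objects -/

section Cardinality

variable {κ : Cardinal.{w}}

theorem nonempty_embedding_of_card_le {T : Type u}
    (h : Cardinal.lift.{w} (Cardinal.mk T) ≤ Cardinal.lift.{u} κ) :
    Nonempty (T ↪ Set.Iio κ.ord) := by
  rw [← Cardinal.mk_out κ, Cardinal.lift_mk_le'] at h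
  obtain ⟨f⟩ := h
  have : Nonempty (κ.out ↪ Set.Iio κ.ord) := by
    rw [← Cardinal.lift_mk_le', Cardinal.mk_Iio_ordinal, Cardinal.card_ord, Cardinal.mk_out]
    simp
  exact ⟨f.trans this.some⟩

theorem nonempty_embedding_sigma (hκ : κ.IsRegular) {T : Type u} {S : T → Type v}
    (hT : Nonempty (T ↪ Set.Iio κ.ord)) (hS : ∀ t, Nonempty (S t ↪ Set.Iio κ.ord)) :
    Nonempty ((Σ t, S t) ↪ Set.Iio κ.ord) := by
  obtain ⟨f⟩ := hT
  have hinf : Cardinal.aleph0 ≤ Cardinal.mk (Set.Iio κ.ord) := by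
    rw [Cardinal.mk_Iio_ordinal, Cardinal.card_ord]
    simpa using hκ.aleph0_le
  obtain ⟨e⟩ := Cardinal.eq.1
    ((Cardinal.mk_prod _ _).trans (by
      simp only [Cardinal.lift_id]
      exact Cardinal.mul_eq_self hinf) :
      Cardinal.mk (Set.Iio κ.ord × Set.Iio κ.ord) = Cardinal.mk (Set.Iio κ.ord))
  refine ⟨⟨fun x => e (f x.1, (hS x.1).some x.2), ?_⟩⟩
  rintro ⟨t, x⟩ ⟨t', x'⟩ h
  obtain ⟨h₁, h₂⟩ := Prod.mk.inj (e.injective h)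
  obtain rfl : t = t' := f.injective h₁
  exact congrArg (Sigma.mk t) ((hS t).some.injective h₂)

end Cardinality

/-- A colimit of a short chain of small objects is small. -/
theorem isSmall_of_isColimit {κ : Cardinal.{w}} (hκ : κ.IsRegular) {A : Type u} [Category.{v} A]
    (hA : AllMono A) {μ : Ordinal.{w}} (hμ : μ < κ.ord) {H : Chain μ A}
    (hH : ∀ i, IsSmall κ A (H.obj i)) {c : Cocone H} (hc : IsColimit c) : IsSmall κ A c.pt := by
  intro K d hd h
  choose j g hg using fun i => hH i K d hd (c.ι.app i ≫ h)
  -- By regularity all factorizations reach a common stage `b`, where the monic leg forces them to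
  -- be compatible.
  obtain ⟨b, hb⟩ := exists_upper_bound hκ hμ j
  have := hA (d.ι.app b)
  refine ⟨b, hc.desc ⟨_, ⟨fun i => g i ≫ K.map (homOfLE (hb i)), fun i i' f => ?_⟩⟩,
    hc.hom_ext fun i => ?_⟩
  · rw [← cancel_mono (d.ι.app b)]
    simp [hg]
  · rw [hc.fac_assoc]
    simp [hg]

/-! ### Comma categories -/

section Comma

variable {κ : Cardinal.{w}} {A : Type u₁} [Category.{v₁} A] {B : Type u₂} [Category.{v₂} B]
  {C : Type u₃} [Category.{v₃} C] {F : A ⥤ C} {G : B ⥤ C}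

/-- The objects of a comma category both of whose components are `κ`-small. -/
def HasSmallComponents (κ : Cardinal.{w}) (F : A ⥤ C) (G : B ⥤ C) : ObjectProperty (Comma F G) :=
  fun X => IsSmall κ A X.left ∧ IsSmall κ B X.right

theorem allMono_comma (hA : AllMono A) (hB : AllMono B) : AllMono (Comma F G) := by
  intro X Y f
  have := hA f.left
  have := hB f.right
  refine ⟨fun g h e => ?_⟩
  ext
  · rw [← cancel_mono f.left]
    exact congrArg CommaMorphism.left e
  · rw [← cancel_mono f.right]
    exact congrArg CommaMorphism.right e

/-- Colimits in a comma category can be recognized on components. -/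
def isColimitOfComponents {J : Type*} [Category* J] {H : J ⥤ Comma F G} (c : Cocone H)
    (h₁ : IsColimit ((Comma.fst F G).mapCocone c)) (h₂ : IsColimit ((Comma.snd F G).mapCocone c))
    (hF : IsColimit (F.mapCocone ((Comma.fst F G).mapCocone c))) : IsColimit c where
  desc s :=
    { left := h₁.desc ((Comma.fst F G).mapCocone s)
      right := h₂.desc ((Comma.snd F G).mapCocone s)
      w := hF.hom_ext fun j => by
        have e₁ : (c.ι.app j).left ≫ h₁.desc ((Comma.fst F G).mapCocone s) = (s.ι.app j).left :=
          h₁.fac ((Comma.fst F G).mapCocone s) j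
        have e₂ : (c.ι.app j).right ≫ h₂.desc ((Comma.snd F G).mapCocone s) = (s.ι.app j).right :=
          h₂.fac ((Comma.snd F G).mapCocone s) j
        have w₁ : F.map (s.ι.app j).left ≫ s.pt.hom = (H.obj j).hom ≫ G.map (s.ι.app j).right :=
          (s.ι.app j).w
        have w₂ : F.map (c.ι.app j).left ≫ c.pt.hom = (H.obj j).hom ≫ G.map (c.ι.app j).right :=
          (c.ι.app j).w
        change F.map (c.ι.app j).left ≫ F.map (h₁.desc ((Comma.fst F G).mapCocone s)) ≫ s.pt.hom =
          F.map (c.ι.app j).left ≫ c.pt.hom ≫ G.map (h₂.desc ((Comma.snd F G).mapCocone s))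
        rw [← F.map_comp_assoc, e₁, reassoc_of% w₂, ← G.map_comp, e₂, w₁] }
  fac s j := by
    ext
    · exact h₁.fac ((Comma.fst F G).mapCocone s) j
    · exact h₂.fac ((Comma.snd F G).mapCocone s) j
  uniq s m hm := by
    ext
    · exact h₁.uniq ((Comma.fst F G).mapCocone s) _ fun j => congrArg CommaMorphism.left (hm j)
    · exact h₂.uniq ((Comma.snd F G).mapCocone s) _ fun j => congrArg CommaMorphism.right (hm j)

/-- The structure map of the componentwise colimit starts at `F` of the left colimit, so it is
induced as soon as `F` preserves that colimit. -/
theorem exists_isColimit_comma (hA : IsAlgebroidal κ A) (hB : IsAlgebroidal κ B)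
    {μ : Ordinal.{w}} (h0 : 0 < μ) (hμ : μ ≤ κ.ord) (hF : IsCocontinuousOnSmall μ κ F)
    (H : Chain μ (Comma F G)) (hH : ∀ i, HasSmallComponents κ F G (H.obj i)) :
    ∃ c : Cocone H, Nonempty (IsColimit c) ∧ Nonempty (IsColimit ((Comma.fst F G).mapCocone c)) ∧
      Nonempty (IsColimit ((Comma.snd F G).mapCocone c)) := by
  have := hA.hasColimit μ h0 hμ (H ⋙ Comma.fst F G) fun i => (hH i).1
  have := hB.hasColimit μ h0 hμ (H ⋙ Comma.snd F G) fun i => (hH i).2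
  have : PreservesColimit (H ⋙ Comma.fst F G) F :=
    preservesColimit_of_preserves_colimit_cocone (colimit.isColimit _)
      (hF _ (fun i => (hH i).1) _ ⟨colimit.isColimit _⟩).some
  refine ⟨Comma.coconeOfPreserves H (colimit.isColimit (H ⋙ Comma.fst F G))
    (colimit.cocone (H ⋙ Comma.snd F G)), ⟨Comma.coconeOfPreservesIsColimit H _
      (colimit.isColimit _)⟩, ⟨?_⟩, ⟨?_⟩⟩
  · exact (colimit.isColimit (H ⋙ Comma.fst F G)).ofIsoColimit
      (Cocone.ext (Iso.refl _) fun _ => Category.comp_id _)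
  · exact (colimit.isColimit (H ⋙ Comma.snd F G)).ofIsoColimit
      (Cocone.ext (Iso.refl _) fun _ => Category.comp_id _)

/-- The components factor separately and are moved to a common stage. The resulting square commutes
after composing with `G` of a leg, which is monic. -/
theorem exists_factor_comma (hA : IsAlgebroidal κ A) (hB : IsAlgebroidal κ B) (h0 : 0 < κ.ord)
    (hBmono : AllMono B) (hF : IsCocontinuous κ F) (hG : G.PreservesMonomorphisms)
    (H : Chain κ.ord (Comma F G)) (c : Cocone H) (hH : ∀ i, HasSmallComponents κ F G (H.obj i))
    (hc : Nonempty (IsColimit c)) (X : Comma F G) (hX : HasSmallComponents κ F G X)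
    (h : X ⟶ c.pt) : ∃ (j : Set.Iio κ.ord) (g : X ⟶ H.obj j), g ≫ c.ι.app j = h := by
  obtain ⟨d, ⟨hd⟩, h₁, h₂⟩ := exists_isColimit_comma hA hB h0 le_rfl
    (fun K _ e he => hF K e he) H hH
  let e := hc.some.coconePointUniqueUpToIso hd
  obtain ⟨i, l, hl⟩ := hX.1 _ _ h₁ (h ≫ e.hom).left
  obtain ⟨j, r, hr⟩ := hX.2 _ _ h₂ (h ≫ e.hom).right
  have hl' : (l ≫ (H.map (homOfLE (le_max_left i j))).left) ≫ (d.ι.app (max i j)).left =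
      (h ≫ e.hom).left := by
    rw [← hl, Category.assoc, ← Comma.comp_left, d.w]
    rfl
  have hr' : (r ≫ (H.map (homOfLE (le_max_right i j))).right) ≫ (d.ι.app (max i j)).right =
      (h ≫ e.hom).right := by
    rw [← hr, Category.assoc, ← Comma.comp_right, d.w]
    rfl
  have := hBmono (d.ι.app (max i j)).right
  let g : X ⟶ H.obj (max i j) :=
    { left := l ≫ (H.map (homOfLE (le_max_left i j))).left
      right := r ≫ (H.map (homOfLE (le_max_right i j))).right
      w := by
        rw [← cancel_mono (G.map (d.ι.app (max i j)).right), Category.assoc, Category.assoc,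
          ← G.map_comp, hr', ← (d.ι.app (max i j)).w, ← F.map_comp_assoc, hl']
        exact (h ≫ e.hom).w }
  refine ⟨max i j, g, ?_⟩
  rw [← cancel_mono e.hom, Category.assoc, hc.some.comp_coconePointUniqueUpToIso_hom]
  ext
  · exact hl'
  · exact hr'

/-- Chains for the two components are aligned: each map from `F.obj (L.obj i)` factors through `G`
of some member of `R`. An increasing reindexing `k` beyond these members gives a chain in the comma
category, and `j ≤ k j` makes `k` cofinal, so the right colimit is unchanged. -/
theorem exists_chain_comma (hκ : κ.IsRegular) (hA : IsAlgebroidal κ A) (hB : IsAlgebroidal κ B)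
    (hBmono : AllMono B) (hF : IsCocontinuous κ F) (hFG : PreservesSmallness κ F G)
    (hG : G.PreservesMonomorphisms) (X : Comma F G) :
    ∃ H : Chain κ.ord (Comma F G), (∀ i, HasSmallComponents κ F G (H.obj i)) ∧
      ∃ t : H ⟶ (Functor.const (Set.Iio κ.ord)).obj X, Nonempty (IsColimit (Cocone.mk X t)) := by
  obtain ⟨L, hL, s, ⟨hs⟩⟩ := hA.exists_chain X.left
  obtain ⟨R, hR, t, ⟨ht⟩⟩ := hB.exists_chain X.right
  choose b g hg using fun i => hFG R _ ⟨ht⟩ _ (hL i) (F.map (s.app i) ≫ X.hom)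
  obtain ⟨k, hk, hkb⟩ := exists_coherent_family (J := Set.Iio κ.ord) (T := fun _ => Set.Iio κ.ord)
    (hT := fun j => ⟨j⟩) (fun _ _ x y => x ≤ y) (fun j _ x => j ≤ x ∧ b j ≤ x) (by
    intro j p _
    obtain ⟨x, hx⟩ := exists_upper_bound hκ j.2 (fun i : Set.Iio j.1 => p (raise j i) i.2)
    exact ⟨max x (max j (b j)), fun i hi => (hx ⟨i.1, hi⟩).trans (le_max_left _ _),
      (le_max_left _ _).trans (le_max_right _ _), (le_max_right _ _).trans (le_max_right _ _)⟩)
  have hmono : Monotone k := fun i j h => by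
    rcases h.eq_or_lt with rfl | h
    · exact le_rfl
    · exact hk i j h
  have hgm : ∀ j, Mono (G.map (t.app j)) := fun j => by
    have := hBmono (t.app j)
    infer_instance
  have hf : ∀ i, ∃ f : F.obj (L.obj i) ⟶ G.obj (R.obj (k i)),
      f ≫ G.map (t.app (k i)) = F.map (s.app i) ≫ X.hom := by
    intro i
    refine ⟨g i ≫ G.map (R.map (homOfLE (hkb i).2)), ?_⟩
    rw [← hg i, Category.assoc, ← G.map_comp, t.naturality]
    simp
  choose f hf using hf
  let H : Chain κ.ord (Comma F G) :=
    { obj := fun i => ⟨L.obj i, R.obj (k i), f i⟩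
      map := fun {i j} m =>
        { left := L.map m
          right := R.map (homOfLE (hmono (leOfHom m)))
          w := by
            dsimp
            rw [← cancel_mono (G.map (t.app (k j))), Category.assoc, Category.assoc, hf,
              ← G.map_comp, ← F.map_comp_assoc, s.naturality, t.naturality]
            simp [hf] }
      map_comp := fun m m' => by
          ext
          · exact L.map_comp m m'
          · exact R.map_comp (homOfLE (hmono (leOfHom m))) (homOfLE (hmono (leOfHom m'))) }
  let c : Cocone H :=
    { pt := X
      ι :=
        { app := fun i => { left := s.app i, right := t.app (k i), w := (hf i).symm }
          naturality := fun i j m => by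
            ext
            · exact s.naturality m
            · exact t.naturality (homOfLE (hmono (leOfHom m))) } }
  have h₁ : IsColimit ((Comma.fst F G).mapCocone c) := hs
  have h₂ : IsColimit ((Comma.snd F G).mapCocone c) :=
    { desc := fun d => ht.desc ⟨d.pt, ⟨fun i => R.map (homOfLE (hkb i).1) ≫ d.ι.app i,
        fun i j m => by
          have := d.w m
          have e : R.map m ≫ R.map (homOfLE (hkb j).1) =
              R.map (homOfLE (hkb i).1) ≫ R.map (homOfLE (hmono (leOfHom m))) := by
            rw [← R.map_comp, ← R.map_comp]
            rfl
          rw [reassoc_of% e, ← this]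
          exact (Category.comp_id _).symm⟩⟩
      fac := fun d i => by
        exact (ht.fac _ (k i)).trans (d.w (homOfLE (hkb i).1))
      uniq := fun d m hm => ht.hom_ext fun i => by
        have e : t.app i = R.map (homOfLE (hkb i).1) ≫ t.app (k i) := by simp
        rw [ht.fac]
        exact (congrArg (· ≫ m) e).trans ((Category.assoc _ _ _).trans
          (congrArg (R.map (homOfLE (hkb i).1) ≫ ·) (hm i))) }
  exact ⟨H, fun i => ⟨hL i, hR _⟩, c.ι, ⟨isColimitOfComponents c h₁ h₂ (hF _ _ ⟨h₁⟩).some⟩⟩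

theorem isSmallBase_comma (hκ : κ.IsRegular) (hA : IsAlgebroidal κ A) (hB : IsAlgebroidal κ B)
    (hAmono : AllMono A) (hBmono : AllMono B) (hF : IsCocontinuous κ F)
    (hFsmall : ∀ μ : Ordinal.{w}, 0 < μ → μ < κ.ord → IsCocontinuousOnSmall μ κ F)
    (hFG : PreservesSmallness κ F G) (hG : G.PreservesMonomorphisms) :
    IsSmallBase κ (HasSmallComponents κ F G) where
  allMono := allMono_comma hAmono hBmono
  exists_colimit μ h0 hμ H hH := by
    obtain ⟨c, hc, ⟨h₁⟩, ⟨h₂⟩⟩ := exists_isColimit_comma hA hB h0 hμ.le (hFsmall μ h0 hμ) H hH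
    exact ⟨c, hc, isSmall_of_isColimit hκ hAmono hμ (fun i => (hH i).1) h₁,
      isSmall_of_isColimit hκ hBmono hμ (fun i => (hH i).2) h₂⟩
  hasColimit H hH := by
    obtain ⟨c, ⟨hc⟩, -⟩ := exists_isColimit_comma hA hB (Cardinal.ord_pos.2 hκ.pos) le_rfl
      (fun K _ e he => hF K e he) H hH
    exact ⟨⟨c, hc⟩⟩
  exists_factor H c hH hc X hX h :=
    exists_factor_comma hA hB (Cardinal.ord_pos.2 hκ.pos) hBmono hF hG H c hH hc X hX h
  exists_chain X := exists_chain_comma hκ hA hB hBmono hF hFG hG X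

/-- Up to isomorphism a map out of `X` is given by two isomorphism classes, a structure map and two
component maps; each is chosen among at most `κ`, and `κ * κ = κ`. -/
theorem hasDominatingMaps_comma (hκ : κ.IsRegular) (hA : IsAlgebroidal κ A)
    (hB : IsAlgebroidal κ B)
    (hcard : ∀ (X : A) (Y : B), IsSmall κ A X → IsSmall κ B Y →
      Cardinal.lift.{w} (Cardinal.mk (F.obj X ⟶ G.obj Y)) ≤ Cardinal.lift.{v₃} κ) :
    HasDominatingMaps κ (HasSmallComponents κ F G) := by
  intro X hX
  let T := Σ (a : Quotient (isIsomorphicSetoid (SmallPart κ A)))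
    (b : Quotient (isIsomorphicSetoid (SmallPart κ B)))
    (_ : F.obj a.out.1 ⟶ G.obj b.out.1) (_ : X.left ⟶ a.out.1), (X.right ⟶ b.out.1)
  have hT : Nonempty (T ↪ Set.Iio κ.ord) :=
    nonempty_embedding_sigma hκ (nonempty_embedding_of_card_le hA.card_isoClasses_le) fun a =>
    nonempty_embedding_sigma hκ (nonempty_embedding_of_card_le hB.card_isoClasses_le) fun b =>
    nonempty_embedding_sigma hκ
      (nonempty_embedding_of_card_le (hcard _ _ a.out.2 b.out.2)) fun _ =>
    nonempty_embedding_sigma hκ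
      (nonempty_embedding_of_card_le (hA.card_hom_le _ _ hX.1 a.out.2)) fun _ =>
    nonempty_embedding_of_card_le (hB.card_hom_le _ _ hX.2 b.out.2)
  let T' := {x : T // F.map x.2.2.2.1 ≫ x.2.2.1 = X.hom ≫ G.map x.2.2.2.2}
  let E : T' → Σ Y : Comma F G, (X ⟶ Y) := fun x =>
    ⟨⟨x.1.1.out.1, x.1.2.1.out.1, x.1.2.2.1⟩, ⟨x.1.2.2.2.1, x.1.2.2.2.2, x.2⟩⟩
  have dom : ∀ Y, HasSmallComponents κ F G Y → ∀ g : X ⟶ Y,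
      ∃ (x : T') (m : Y ⟶ (E x).1), g ≫ m = (E x).2 := by
    intro Y hY g
    let a : Quotient (isIsomorphicSetoid (SmallPart κ A)) := Quotient.mk _ ⟨Y.left, hY.1⟩
    let b : Quotient (isIsomorphicSetoid (SmallPart κ B)) := Quotient.mk _ ⟨Y.right, hY.2⟩
    obtain ⟨α⟩ : Nonempty (a.out ≅ ⟨Y.left, hY.1⟩) := Quotient.mk_out (s := isIsomorphicSetoid _) _
    obtain ⟨β⟩ : Nonempty (b.out ≅ ⟨Y.right, hY.2⟩) := Quotient.mk_out (s := isIsomorphicSetoid _) _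
    let α' : a.out.1 ≅ Y.left := (smallIncl κ A).mapIso α
    let β' : b.out.1 ≅ Y.right := (smallIncl κ B).mapIso β
    refine ⟨⟨⟨a, b, F.map α'.hom ≫ Y.hom ≫ G.map β'.inv, g.left ≫ α'.inv, g.right ≫ β'.inv⟩, ?_⟩,
      ⟨α'.inv, β'.inv, ?_⟩, ?_⟩
    · simp
    · simp [E]
    · rfl
  -- Nonemptiness lets `Function.invFun` turn the injection into a surjective enumeration by `κ`.
  have : Nonempty T' := (dom X hX (𝟙 X)).nonempty
  obtain ⟨f⟩ := hT
  have hf : Function.Injective fun x : T' => f x.1 := f.injective.comp Subtype.val_injective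
  refine ⟨fun t => E (Function.invFun (fun x : T' => f x.1) t), fun t => ⟨?_, ?_⟩, ?_⟩
  · exact (Quotient.out (s := isIsomorphicSetoid (SmallPart κ _)) _).2
  · exact (Quotient.out (s := isIsomorphicSetoid (SmallPart κ _)) _).2
  · intro Y hY g
    obtain ⟨x, m, hm⟩ := dom Y hY g
    obtain ⟨t, rfl⟩ := Function.invFun_surjective hf x
    exact ⟨t, m, hm⟩

/-- The relative property is the case of equal right components; JEP in `B` reduces the general case
to it. -/
theorem jointEmbedding_comma_iff (hB : HasJEP (SmallPart κ B)) :
    JointEmbedding (HasSmallComponents κ F G) ↔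
      HasRelJEP (smallIncl κ A ⋙ F) (smallIncl κ B ⋙ G) := by
  constructor
  · intro h B₁ B₂ T h₁ h₂
    obtain ⟨Z, f, g, hZ⟩ := h ⟨B₁.1, T.1, h₁⟩ ⟨B₂.1, T.1, h₂⟩ ⟨B₁.2, T.2⟩ ⟨B₂.2, T.2⟩
    exact ⟨⟨Z.left, hZ.1⟩, ⟨Z.right, hZ.2⟩, ObjectProperty.homMk f.left,
      ObjectProperty.homMk g.left, Z.hom, ObjectProperty.homMk f.right,
      ObjectProperty.homMk g.right, f.w, g.w⟩
  · intro h X Y hX hY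
    obtain ⟨T, r, s, -⟩ := hB ⟨X.right, hX.2⟩ ⟨Y.right, hY.2⟩
    obtain ⟨D, T', f₁, f₂, d, k₁, k₂, e₁, e₂⟩ := h ⟨X.left, hX.1⟩ ⟨Y.left, hY.1⟩ T
      (X.hom ≫ G.map r.hom) (Y.hom ≫ G.map s.hom)
    refine ⟨⟨D.1, T'.1, d⟩, ⟨f₁.hom, r.hom ≫ k₁.hom, ?_⟩, ⟨f₂.hom, s.hom ≫ k₂.hom, ?_⟩, D.2, T'.2⟩
    · exact e₁.trans (by simp)
    · exact e₂.trans (by simp)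

/-- The relative property concerns spans whose right components are identities of `T`, which forces
the two right legs of an amalgam to coincide in a single `k`. Amalgamating right components in `B`
first reduces any span to a common `T`. -/
theorem amalgamation_comma_iff (hB : HasAP (SmallPart κ B)) :
    Amalgamation (HasSmallComponents κ F G) ↔
      HasRelAP (smallIncl κ A ⋙ F) (smallIncl κ B ⋙ G) := by
  constructor
  · intro h X B₁ B₂ f₁ f₂ T h₁ h₂ e
    let Y : Comma F G := ⟨X.1, T.1, F.map f₁.hom ≫ h₁⟩
    let Y₁ : Comma F G := ⟨B₁.1, T.1, h₁⟩
    let Y₂ : Comma F G := ⟨B₂.1, T.1, h₂⟩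
    let g₁ : Y ⟶ Y₁ := ⟨f₁.hom, 𝟙 _, by simp [Y, Y₁]⟩
    let g₂ : Y ⟶ Y₂ := ⟨f₂.hom, 𝟙 _, e.symm.trans (by simp [Y, Y₂])⟩
    obtain ⟨W, a, b, hW, hab⟩ := h Y Y₁ Y₂ g₁ g₂ ⟨X.2, T.2⟩ ⟨B₁.2, T.2⟩ ⟨B₂.2, T.2⟩
    have hl : f₁.hom ≫ b.left = f₂.hom ≫ a.left := congrArg CommaMorphism.left hab
    have hr : b.right = a.right := by
      simpa [g₁, g₂, Y, Y₁, Y₂] using congrArg CommaMorphism.right hab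
    refine ⟨⟨W.left, hW.1⟩, ObjectProperty.homMk b.left, ObjectProperty.homMk a.left,
      ⟨W.right, hW.2⟩, ObjectProperty.homMk a.right, W.hom, ?_, ?_, a.w⟩
    · ext
      exact hl
    · exact b.w.trans (congrArg (h₁ ≫ G.map ·) hr)
  · intro h X Y Z f g hX hY hZ
    obtain ⟨T, s, r, hrs⟩ := hB ⟨X.right, hX.2⟩ ⟨Y.right, hY.2⟩ ⟨Z.right, hZ.2⟩
      (ObjectProperty.homMk f.right) (ObjectProperty.homMk g.right)
    have hrs' : f.right ≫ r.hom = g.right ≫ s.hom := congrArg (·.hom) hrs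
    obtain ⟨D, g₁, g₂, T', k, d, e, e₁, e₂⟩ := h ⟨X.left, hX.1⟩ ⟨Y.left, hY.1⟩ ⟨Z.left, hZ.1⟩
      (ObjectProperty.homMk f.left) (ObjectProperty.homMk g.left) T
      (Y.hom ≫ G.map r.hom) (Z.hom ≫ G.map s.hom) (by
        have h₁ := f.w_assoc (G.map r.hom)
        have h₂ := g.w_assoc (G.map s.hom)
        rw [← G.map_comp] at h₁ h₂
        rw [hrs'] at h₁
        exact h₁.trans h₂.symm)
    have e' : f.left ≫ g₁.hom = g.left ≫ g₂.hom := congrArg (·.hom) e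
    refine ⟨⟨D.1, T'.1, d⟩, ⟨g₂.hom, s.hom ≫ k.hom, ?_⟩, ⟨g₁.hom, r.hom ≫ k.hom, ?_⟩,
      ⟨D.2, T'.2⟩, ?_⟩
    · exact e₂.trans (by simp)
    · exact e₁.trans (by simp)
    · ext
      · exact e'
      · simp [reassoc_of% hrs']

end Comma

end CommaFraisse

theorem mainTheorem1
    (κ : Cardinal.{w}) (hκ : κ.IsRegular)
    (A : Type u₁) [Category.{v₁} A] (B : Type u₂) [Category.{v₂} B]
    (C : Type u₃) [Category.{v₃} C]
    (hA : CommaFraisse.IsAlgebroidal κ A) (hB : CommaFraisse.IsAlgebroidal κ B)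
    (hAmono : CommaFraisse.AllMono A) (hBmono : CommaFraisse.AllMono B)
    (hBJEP : CommaFraisse.HasJEP (CommaFraisse.SmallPart κ B))
    (hBAP : CommaFraisse.HasAP (CommaFraisse.SmallPart κ B))
    (F : A ⥤ C) (G : B ⥤ C)
    (hne : Nonempty (Comma F G))
    (hF : CommaFraisse.IsCocontinuous κ F)
    (hFsmall : ∀ μ : Ordinal.{w}, 0 < μ → μ < κ.ord →
      CommaFraisse.IsCocontinuousOnSmall μ κ F)
    (hFG : CommaFraisse.PreservesSmallness κ F G)
    (hG : CommaFraisse.IsCocontinuousOnSmall κ.ord κ G)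
    (hGmono : G.PreservesMonomorphisms)
    (hcard : ∀ (X : A) (Y : B), CommaFraisse.IsSmall κ A X → CommaFraisse.IsSmall κ B Y →
      Cardinal.lift.{w} (Cardinal.mk (F.obj X ⟶ G.obj Y)) ≤ Cardinal.lift.{v₃} κ) :
    (∃ U : Comma F G, CommaFraisse.IsUniversal (⊤ : ObjectProperty (Comma F G)) U ∧
      CommaFraisse.IsHomogeneous (CommaFraisse.IsSmall κ (Comma F G)) U) ↔
    (CommaFraisse.HasRelJEP (CommaFraisse.smallIncl κ A ⋙ F) (CommaFraisse.smallIncl κ B ⋙ G) ∧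
      CommaFraisse.HasRelAP (CommaFraisse.smallIncl κ A ⋙ F) (CommaFraisse.smallIncl κ B ⋙ G)) := by
  rw [← CommaFraisse.jointEmbedding_comma_iff hBJEP, ← CommaFraisse.amalgamation_comma_iff hBAP]
  exact (CommaFraisse.isSmallBase_comma hκ hA hB hAmono hBmono hF hFsmall hFG
    hGmono).exists_isUniversal_isHomogeneous_iff hκ
      (CommaFraisse.hasDominatingMaps_comma hκ hA hB hcard) hne
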